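/- Let $a\ge 1$ be an integer. For $n\ge 1$ and $r>0$, consider $n$ sensors whose initial positions $X_1,\dots,X_n$ are independent and uniformly distributed on $[0,1]$. A final placement $(b_1,\dots,b_n)\in\mathbb{R}^n$ of sensors of range $r$ covers $[0,1]$ if every $y\in[0,1]$ satisfies $|y-b_i|\le r$ for some $i$. Let $$E_n^{(a)}(r)=\mathbb{E}\Big[\min\Big\{\sum_{i=1}^n |X_i-b_i|^a \;:\; (b_1,\dots,b_n)\text{ covers }[0,1]\Big\}\Big]$$ be the expected minimum sum of displacements to the power $a$ needed to cover $[0,1]$. Let $f:\mathbb{N}\to\mathbb{R}$ satisfy $f(n)>0$ for all $n\ge 1$ and $f(n)=o(n^{-3/2})$ as $n\to\infty$, and let the sensor range be $r_n=\frac{1}{2n}+\frac{f(n)}{2}$. Then $$E_n^{(a)}(r_n)=\Theta\!\left(\frac{1}{n^{a/2-1}}\right)\qquad (n\to\infty).$$ -/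

import Mathlib

open Filter Asymptotics MeasureTheory

noncomputable section

namespace SensorCover

/-- The sensors at positions `b i` on the line, each of range `r`, cover the unit interval:
every point of `[0,1]` is at distance at most `r` from some sensor. -/
def Covers {n : ℕ} (r : ℝ) (b : Fin n → ℝ) : Prop :=
  ∀ y ∈ Set.Icc (0 : ℝ) 1, ∃ i, |y - b i| ≤ r

/-- The sum of the displacements to the power `a` when, for each `i`, the `i`th sensor moves
from `x i` to `b i`. -/
def cost {n : ℕ} (a : ℕ) (x b : Fin n → ℝ) : ℝ :=
  ∑ i, |x i - b i| ^ a

/-- The minimum sum of displacements to the power `a`, over all final placements that cover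
`[0,1]`, for `n` sensors of range `r` with initial positions `x`. -/
def minCost {n : ℕ} (a : ℕ) (r : ℝ) (x : Fin n → ℝ) : ℝ :=
  sInf {c : ℝ | ∃ b : Fin n → ℝ, Covers r b ∧ c = cost a x b}

/-- The uniform distribution on `[0,1]`. -/
def uniformLaw : Measure ℝ := volume.restrict (Set.Icc (0 : ℝ) 1)

instance : IsProbabilityMeasure uniformLaw :=
  ⟨by simp [uniformLaw]⟩

/-- The expected minimum sum of displacements to the power `a` for `n` sensors of range `r`
whose initial positions are independent and uniformly distributed on `[0,1]`. -/
def expectedMinCost (n a : ℕ) (r : ℝ) : ℝ :=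
  ∫ x : Fin n → ℝ, minCost a r x ∂(Measure.pi fun _ => uniformLaw)

end SensorCover

end

namespace SensorCover

open scoped Nat

/-! Both bounds compare the cost with fluctuations of order `√n` of sums of independent variables.

Upper bound: send the sensor of rank `k` (counted from 0) to `(k + 1/2) / n`. Given `x j`, its rank
is a sum of independent indicators with mean `x j` each, so it deviates from its mean by order `√n`
in every moment (`integral_abs_sum_pow_le`). Each sensor thus moves by order `1 / √n`, and the total
is of order `n * (1 / √n) ^ a`.

Lower bound: a cover with little overlap has almost no freedom in its barycentre. With overlap
parameter `d = f n`, the sum of the final positions, truncated to the unit interval, is `n / 2` up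
to order `n ^ 2 * d + 1` (`abs_sum_clamp_sub_le`), which is `o(√n)` by the hypothesis on `f`. The
initial sum has mean deviation at least `√n / 1440` from `n / 2` (`le_integral_abs_sum_sub_half`),
so the total displacement has mean at least of order `√n`. A tangent line to `t ^ a` at height `1 /
√n` turns this into the bound for the power `a` (`le_minCost`). -/

/-! ### Moments of sums of bounded centred variables -/

/-- A centred random variable bounded by `1` has moment generating function at most
`exp (s ^ 2)` for `|s| ≤ 1`. -/
theorem integral_exp_mul_le {μ : Measure ℝ} [IsProbabilityMeasure μ] {g : ℝ → ℝ}
    (hg : Measurable g) (hb : ∀ᵐ t ∂μ, |g t| ≤ 1) (h0 : ∫ t, g t ∂μ = 0) {s : ℝ}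
    (hs : |s| ≤ 1) :
    Integrable (fun t => Real.exp (s * g t)) μ ∧
      ∫ t, Real.exp (s * g t) ∂μ ≤ Real.exp (s ^ 2) := by
  have hgi : Integrable g μ := Integrable.of_bound hg.aestronglyMeasurable 1 hb
  have hsg : ∀ᵐ t ∂μ, |s * g t| ≤ 1 := by
    filter_upwards [hb] with t ht
    rw [abs_mul]
    exact mul_le_one₀ hs (abs_nonneg _) ht
  have hi : Integrable (fun t => Real.exp (s * g t)) μ := by
    refine Integrable.of_bound (by fun_prop) (Real.exp 1) ?_
    filter_upwards [hsg] with t ht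
    rw [Real.norm_eq_abs, Real.abs_exp]
    exact Real.exp_le_exp.2 ((le_abs_self _).trans ht)
  refine ⟨hi, ?_⟩
  -- `exp u ≤ 1 + u + u ^ 2` for `|u| ≤ 1`; the linear term has mean zero.
  have hle : ∫ t, Real.exp (s * g t) ∂μ ≤ ∫ t, ((1 + s ^ 2) + s * g t) ∂μ := by
    refine integral_mono_ae hi ((integrable_const _).add (hgi.const_mul s)) ?_
    filter_upwards [hb, hsg] with t ht hst
    have h1 := (abs_le.1 (Real.abs_exp_sub_one_sub_id_le hst)).2
    have h2 : (s * g t) ^ 2 ≤ s ^ 2 := by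
      rw [mul_pow]
      exact mul_le_of_le_one_right (sq_nonneg s) ((sq_le_one_iff_abs_le_one _).2 ht)
    linarith
  rw [integral_add (integrable_const _) (hgi.const_mul s), integral_const_mul, h0] at hle
  simp only [integral_const, probReal_univ, smul_eq_mul, one_mul, mul_zero, add_zero] at hle
  linarith [Real.add_one_le_exp (s ^ 2)]

/-- Moments of sums of independent centred random variables bounded by `1`. -/
theorem integral_abs_sum_pow_le {m N : ℕ} (hN : 1 ≤ N) (hmN : m ≤ N) {μ : Measure ℝ}
    [IsProbabilityMeasure μ] {g : Fin m → ℝ → ℝ} (hg : ∀ k, Measurable (g k))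
    (hb : ∀ k, ∀ᵐ t ∂μ, |g k t| ≤ 1) (h0 : ∀ k, ∫ t, g k t ∂μ = 0) (a : ℕ) :
    ∫ y : Fin m → ℝ, |∑ k, g k (y k)| ^ a ∂(Measure.pi fun _ => μ) ≤
      2 * a ! * Real.exp 1 * √N ^ a := by
  have hN0 : (0 : ℝ) < N := by exact_mod_cast hN
  have hr : 0 < √(N : ℝ) := Real.sqrt_pos.2 hN0
  -- At `s = ±1 / √N` the `m ≤ N` factors `exp (s ^ 2)` multiply to at most `exp 1`.
  have hmgf : ∀ s : ℝ, s ^ 2 = 1 / N →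
      Integrable (fun y : Fin m → ℝ => Real.exp (s * ∑ k, g k (y k))) (Measure.pi fun _ => μ) ∧
        ∫ y : Fin m → ℝ, Real.exp (s * ∑ k, g k (y k)) ∂(Measure.pi fun _ => μ) ≤
          Real.exp 1 := by
    intro s hs
    have hs1 : |s| ≤ 1 := by
      rw [← sq_le_one_iff_abs_le_one, hs, div_le_one hN0]
      exact_mod_cast hN
    have hprod : (fun y : Fin m → ℝ => Real.exp (s * ∑ k, g k (y k))) =
        fun y => ∏ k, Real.exp (s * g k (y k)) := by
      funext y
      rw [← Real.exp_sum, Finset.mul_sum]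
    rw [hprod]
    refine ⟨Integrable.fintype_prod (f := fun k t => Real.exp (s * g k t))
      (fun k => (integral_exp_mul_le (hg k) (hb k) (h0 k) hs1).1), ?_⟩
    rw [integral_fintype_prod_eq_prod (fun k t => Real.exp (s * g k t))]
    calc ∏ k, ∫ t, Real.exp (s * g k t) ∂μ
        ≤ ∏ _k : Fin m, Real.exp (s ^ 2) :=
          Finset.prod_le_prod (fun k _ => integral_nonneg fun t => (Real.exp_pos _).le)
            (fun k _ => (integral_exp_mul_le (hg k) (hb k) (h0 k) hs1).2)
      _ = Real.exp (m * s ^ 2) := by simp [← Real.exp_nat_mul]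
      _ ≤ Real.exp 1 := by
          rw [Real.exp_le_exp, hs, mul_one_div, div_le_one hN0]
          exact_mod_cast hmN
  have hsq : (√(N : ℝ))⁻¹ ^ 2 = 1 / N := by
    rw [inv_pow, Real.sq_sqrt hN0.le, one_div]
  obtain ⟨hi1, hl1⟩ := hmgf (√N)⁻¹ hsq
  obtain ⟨hi2, hl2⟩ := hmgf (-(√N)⁻¹) (by rw [neg_sq, hsq])
  have hpt : ∀ y : Fin m → ℝ, |∑ k, g k (y k)| ^ a ≤ (a ! * √N ^ a) *
      (Real.exp ((√N)⁻¹ * ∑ k, g k (y k)) + Real.exp (-(√N)⁻¹ * ∑ k, g k (y k))) := by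
    intro y
    set S := ∑ k, g k (y k)
    have h1 := Real.pow_div_factorial_le_exp (x := |(√N)⁻¹ * S|) (abs_nonneg _) a
    have h2 := Real.exp_abs_le ((√N)⁻¹ * S)
    rw [div_le_iff₀ (by positivity), abs_mul, abs_of_pos (inv_pos.2 hr), mul_pow, inv_pow,
      inv_mul_le_iff₀ (by positivity)] at h1
    rw [abs_mul, abs_of_pos (inv_pos.2 hr)] at h2
    rw [neg_mul]
    calc |S| ^ a ≤ √N ^ a * (Real.exp ((√N)⁻¹ * |S|) * a !) := h1
      _ = (a ! * √N ^ a) * Real.exp ((√N)⁻¹ * |S|) := by ring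
      _ ≤ _ := by gcongr
  calc ∫ y : Fin m → ℝ, |∑ k, g k (y k)| ^ a ∂(Measure.pi fun _ => μ)
      ≤ ∫ y : Fin m → ℝ, (a ! * √N ^ a) *
      (Real.exp ((√N)⁻¹ * ∑ k, g k (y k)) + Real.exp (-(√N)⁻¹ * ∑ k, g k (y k)))
        ∂(Measure.pi fun _ => μ) :=
        integral_mono_of_nonneg (ae_of_all _ fun y => by positivity) ((hi1.add hi2).const_mul _)
          (ae_of_all _ hpt)
    _ ≤ (a ! * √N ^ a) * (Real.exp 1 + Real.exp 1) := by
        rw [integral_const_mul, integral_add hi1 hi2]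
        gcongr
    _ = _ := by ring

/-! ### The minimum cost and the evenly spaced placement -/

/-- An infimum of continuous functions, even an uncountable one, is upper semicontinuous. -/
theorem measurable_minCost {n : ℕ} (a : ℕ) (r : ℝ) :
    Measurable (minCost a r : (Fin n → ℝ) → ℝ) := by
  have h : (minCost a r : (Fin n → ℝ) → ℝ) =
      fun x => ⨅ b : {b : Fin n → ℝ // Covers r b}, cost a x b := by
    funext x
    rw [minCost, iInf]
    congr 1
    ext c
    simp [eq_comm]
  rw [h]
  refine (upperSemicontinuous_ciInf ?_ fun b => ?_).measurable
  · rintro x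
    refine ⟨0, ?_⟩
    rintro _ ⟨b, rfl⟩
    exact Finset.sum_nonneg fun i _ => by positivity
  · refine Continuous.upperSemicontinuous ?_
    unfold cost
    fun_prop

theorem cost_nonneg {n : ℕ} (a : ℕ) (x b : Fin n → ℝ) : 0 ≤ cost a x b :=
  Finset.sum_nonneg fun i _ => by positivity

theorem minCost_nonneg {n : ℕ} (a : ℕ) (r : ℝ) (x : Fin n → ℝ) : 0 ≤ minCost a r x := by
  refine Real.sInf_nonneg ?_
  rintro _ ⟨b, -, rfl⟩
  exact cost_nonneg a x b

theorem minCost_le_cost {n : ℕ} (a : ℕ) {r : ℝ} (x : Fin n → ℝ) {b : Fin n → ℝ}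
    (hb : Covers r b) : minCost a r x ≤ cost a x b := by
  refine csInf_le ⟨0, ?_⟩ ⟨b, hb, rfl⟩
  rintro _ ⟨b, -, rfl⟩
  exact cost_nonneg a x b

/-- The evenly spaced placement covers the unit interval. -/
theorem covers_of_perm {n : ℕ} {r : ℝ} (hn : 1 ≤ n) (hr : 1 / (2 * (n : ℝ)) ≤ r)
    {p : Fin n → Fin n} (hp : Function.Surjective p) :
    Covers r fun j => ((p j : ℕ) + 1 / 2 : ℝ) / n := by
  have hn0 : (0 : ℝ) < n := by exact_mod_cast hn
  intro y hy
  obtain ⟨i, hi1, hi2⟩ : ∃ i : Fin n, ((i : ℕ) : ℝ) ≤ n * y ∧ n * y ≤ (i : ℕ) + 1 := by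
    -- At `y = 1` the floor of `n * y` is `n`, out of range; the last cell takes this point.
    rcases eq_or_lt_of_le hy.2 with h | h
    · refine ⟨⟨n - 1, by omega⟩, ?_⟩
      simp [h, Nat.cast_sub hn]
    · have h0 : 0 ≤ n * y := mul_nonneg hn0.le hy.1
      refine ⟨⟨⌊n * y⌋₊, ?_⟩, Nat.floor_le h0, (Nat.lt_floor_add_one _).le⟩
      rw [Nat.floor_lt h0]
      exact mul_lt_of_lt_one_right hn0 h
  obtain ⟨j, rfl⟩ := hp i
  refine ⟨j, le_trans ?_ hr⟩
  have h : y - ((p j : ℕ) + 1 / 2 : ℝ) / n = (n * y - ((p j : ℕ) + 1 / 2)) / n := by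
    field_simp
  rw [h, abs_div, abs_of_pos hn0, div_le_div_iff₀ hn0 (by positivity)]
  have : |n * y - ((p j : ℕ) + 1 / 2)| ≤ 1 / 2 := abs_le.2 ⟨by linarith, by linarith⟩
  nlinarith

/-- The rank of `x j` among the coordinates of `x`, ties being broken by the index. -/
noncomputable def rank {n : ℕ} (x : Fin n → ℝ) (j : Fin n) : ℕ :=
  ∑ k, if x k < x j ∨ x k = x j ∧ k < j then 1 else 0

theorem rank_lt_rank {n : ℕ} {x : Fin n → ℝ} {i j : Fin n}
    (h : x i < x j ∨ x i = x j ∧ i < j) : rank x i < rank x j := by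
  refine Finset.sum_lt_sum (fun k _ => ?_) ⟨i, Finset.mem_univ i, ?_⟩
  · split_ifs with h1 h2
    · exact le_rfl
    · exfalso
      apply h2
      rcases h with h | ⟨h, h'⟩ <;> rcases h1 with h1 | ⟨h1, h1'⟩
      · exact Or.inl (h1.trans h)
      · exact Or.inl (h1 ▸ h)
      · exact Or.inl (h ▸ h1)
      · exact Or.inr ⟨h1.trans h, h1'.trans h'⟩
    · simp
    · simp
  · simp [h]

theorem rank_lt {n : ℕ} (x : Fin n → ℝ) (j : Fin n) : rank x j < n := by
  calc rank x j < ∑ _k : Fin n, 1 := by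
        refine Finset.sum_lt_sum (fun k _ => ?_) ⟨j, Finset.mem_univ j, by simp⟩
        split_ifs <;> simp
    _ = n := by simp

/-- Breaking ties makes the rank injective for every `x`, so no null set of ties has to be removed.
-/
theorem rank_surjective {n : ℕ} (x : Fin n → ℝ) :
    Function.Surjective fun j => (⟨rank x j, rank_lt x j⟩ : Fin n) := by
  refine Finite.surjective_of_injective fun i j hij => ?_
  by_contra hne
  have hr : rank x i = rank x j := congrArg Fin.val hij
  rcases lt_trichotomy (x i) (x j) with h | h | h
  · exact (rank_lt_rank (Or.inl h)).ne hr
  · rcases lt_or_gt_of_ne hne with h' | h'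
    · exact (rank_lt_rank (Or.inr ⟨h, h'⟩)).ne hr
    · exact (rank_lt_rank (Or.inr ⟨h.symm, h'⟩)).ne' hr
  · exact (rank_lt_rank (Or.inl h)).ne' hr

theorem minCost_le_sum_rank {n : ℕ} (a : ℕ) {r : ℝ} (hn : 1 ≤ n) (hr : 1 / (2 * (n : ℝ)) ≤ r)
    (x : Fin n → ℝ) :
    minCost a r x ≤ ∑ j, |x j - (rank x j + 1 / 2 : ℝ) / n| ^ a := by
  have h := minCost_le_cost a x (covers_of_perm hn hr (rank_surjective x))
  simpa only [cost] using h

theorem ae_mem_Icc : ∀ᵐ t ∂uniformLaw, t ∈ Set.Icc (0 : ℝ) 1 :=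
  ae_restrict_mem measurableSet_Icc

theorem ae_pi_mem_Icc (n : ℕ) :
    ∀ᵐ x : Fin n → ℝ ∂(Measure.pi fun _ => uniformLaw), ∀ i, x i ∈ Set.Icc (0 : ℝ) 1 :=
  ae_all_iff.2 fun i =>
    (measurePreserving_eval (fun _ : Fin n => uniformLaw) i).quasiMeasurePreserving.ae ae_mem_Icc

theorem rank_cast_add_le {n : ℕ} (hn : 1 ≤ n) (x : Fin n → ℝ) (j : Fin n) :
    0 ≤ (rank x j + 1 / 2 : ℝ) / n ∧ (rank x j + 1 / 2 : ℝ) / n ≤ 1 := by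
  have hn0 : (0 : ℝ) < n := by exact_mod_cast hn
  have h : (rank x j : ℝ) + 1 ≤ n := by exact_mod_cast rank_lt x j
  exact ⟨by positivity, by rw [div_le_one hn0]; linarith⟩

theorem integrable_minCost {n : ℕ} (a : ℕ) {r : ℝ} (hn : 1 ≤ n)
    (hr : 1 / (2 * (n : ℝ)) ≤ r) :
    Integrable (minCost a r : (Fin n → ℝ) → ℝ) (Measure.pi fun _ => uniformLaw) := by
  refine Integrable.of_bound (measurable_minCost a r).aestronglyMeasurable n ?_
  filter_upwards [ae_pi_mem_Icc n] with x hx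
  rw [Real.norm_eq_abs, abs_of_nonneg (minCost_nonneg a r x)]
  refine (minCost_le_sum_rank a hn hr x).trans ?_
  calc ∑ j, |x j - (rank x j + 1 / 2 : ℝ) / n| ^ a ≤ ∑ _j : Fin n, (1 : ℝ) := by
        refine Finset.sum_le_sum fun j _ => pow_le_one₀ (abs_nonneg _) ?_
        have h1 := rank_cast_add_le hn x j
        have h2 := hx j
        exact abs_le.2 ⟨by linarith [h2.1], by linarith [h2.2]⟩
    _ = n := by simp


/-! ### Fluctuations of the rank and the upper bound -/

theorem integral_indicator_sub_eq_zero {t : ℝ} (ht : t ∈ Set.Icc (0 : ℝ) 1) (p : Prop)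
    [Decidable p] :
    ∫ s, ((if s < t ∨ s = t ∧ p then 1 else 0) - t : ℝ) ∂uniformLaw = 0 := by
  have hae : ∀ᵐ s ∂uniformLaw, ((if s < t ∨ s = t ∧ p then 1 else 0) - t : ℝ) =
      (Set.Iio t).indicator 1 s - t := by
    have h : ∀ᵐ s ∂uniformLaw, s ≠ t :=
      ae_restrict_of_ae (Measure.ae_ne volume t)
    filter_upwards [h] with s hs
    simp [Set.indicator, hs]
  have hvol : uniformLaw.real (Set.Iio t) = t := by
    have hI : Set.Iio t ∩ Set.Icc (0 : ℝ) 1 = Set.Ico 0 t := by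
      ext s
      simp only [Set.mem_inter_iff, Set.mem_Iio, Set.mem_Icc, Set.mem_Ico]
      constructor
      · rintro ⟨h1, h2, -⟩
        exact ⟨h2, h1⟩
      · rintro ⟨h1, h2⟩
        exact ⟨h2, h1, h2.le.trans ht.2⟩
    rw [measureReal_def, uniformLaw, Measure.restrict_apply measurableSet_Iio, hI,
      Real.volume_Ico, sub_zero, ENNReal.toReal_ofReal ht.1]
  have hi : Integrable ((Set.Iio t).indicator (1 : ℝ → ℝ)) uniformLaw :=
    (integrable_const (1 : ℝ)).indicator measurableSet_Iio
  rw [integral_congr_ae hae, integral_sub hi (integrable_const t), integral_indicator_one measurableSet_Iio, hvol]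
  simp

theorem measurable_indicator_lex {α : Type*} [MeasurableSpace α] {u v : α → ℝ}
    (hu : Measurable u) (hv : Measurable v) (p : Prop) [Decidable p] :
    Measurable fun y => (if u y < v y ∨ u y = v y ∧ p then 1 else 0 : ℝ) := by
  refine Measurable.ite ?_ measurable_const measurable_const
  refine (measurableSet_lt hu hv).union ?_
  exact (measurableSet_eq_fun hu hv).inter (MeasurableSet.const p)

/-- The centred number of other sensors to the left of the `j`th one. -/
noncomputable def centredRank {m : ℕ} (j : Fin (m + 1)) (t : ℝ) (y : Fin m → ℝ) : ℝ :=
  ∑ k, ((if y k < t ∨ y k = t ∧ j.succAbove k < j then 1 else 0) - t : ℝ)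

theorem measurable_centredRank {m : ℕ} (j : Fin (m + 1)) :
    Measurable fun z : ℝ × (Fin m → ℝ) => centredRank j z.1 z.2 := by
  refine Finset.measurable_sum _ fun k _ => Measurable.sub ?_ measurable_fst
  exact measurable_indicator_lex (by fun_prop) measurable_fst _

theorem abs_indicator_sub_le {t : ℝ} (ht : t ∈ Set.Icc (0 : ℝ) 1) (p : Prop) [Decidable p] :
    |((if p then 1 else 0) - t : ℝ)| ≤ 1 := by
  obtain ⟨h0, h1⟩ := ht
  split_ifs <;> exact abs_le.2 ⟨by linarith, by linarith⟩

theorem abs_centredRank_le {m : ℕ} (j : Fin (m + 1)) {t : ℝ} (ht : t ∈ Set.Icc (0 : ℝ) 1)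
    (y : Fin m → ℝ) : |centredRank j t y| ≤ m := by
  refine (Finset.abs_sum_le_sum_abs _ _).trans ?_
  calc _ ≤ ∑ _k : Fin m, (1 : ℝ) := Finset.sum_le_sum fun k _ => abs_indicator_sub_le ht _
    _ = m := by simp

theorem integral_abs_centredRank_pow_le {m : ℕ} (j : Fin (m + 1)) {t : ℝ}
    (ht : t ∈ Set.Icc (0 : ℝ) 1) (a : ℕ) :
    ∫ y, |centredRank j t y| ^ a ∂(Measure.pi fun _ => uniformLaw) ≤
      2 * a ! * Real.exp 1 * √((m + 1 : ℕ) : ℝ) ^ a := by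
  refine integral_abs_sum_pow_le (by omega) (by omega)
    (g := fun k s => ((if s < t ∨ s = t ∧ j.succAbove k < j then 1 else 0) - t : ℝ))
    (fun k => ?_) (fun k => ae_of_all _ fun s => abs_indicator_sub_le ht _)
    (fun k => integral_indicator_sub_eq_zero ht _) a
  exact (measurable_indicator_lex measurable_id measurable_const _).sub measurable_const

/-- The `j`th summand of the rank vanishes, so once `x j` is fixed only independent centred terms
from the other sensors remain. -/
theorem rank_sub_eq {m : ℕ} (x : Fin (m + 1) → ℝ) (j : Fin (m + 1)) :
    (rank x j : ℝ) - m * x j = centredRank j (x j) fun k => x (j.succAbove k) := by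
  rw [rank, Fin.sum_univ_succAbove _ j, centredRank, Finset.sum_sub_distrib]
  simp

/-- The mean displacement to the power `a` of a sensor moved according to its rank. -/
theorem integral_abs_sub_rank_pow_le {m : ℕ} (a : ℕ) (j : Fin (m + 1)) :
    Integrable (fun x : Fin (m + 1) → ℝ => |x j - (rank x j + 1 / 2 : ℝ) / (m + 1 : ℕ)| ^ a)
      (Measure.pi fun _ => uniformLaw) ∧
    ∫ x : Fin (m + 1) → ℝ, |x j - (rank x j + 1 / 2 : ℝ) / (m + 1 : ℕ)| ^ a
      ∂(Measure.pi fun _ => uniformLaw) ≤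
      2 ^ a * (2 * a ! * Real.exp 1 + 1) * (1 / √((m + 1 : ℕ) : ℝ)) ^ a := by
  set N : ℝ := ((m + 1 : ℕ) : ℝ) with hN
  have hN1 : 1 ≤ N := by rw [hN]; exact_mod_cast Nat.succ_pos m
  have hN0 : 0 < N := by linarith
  have hr1 : 1 ≤ √N := Real.one_le_sqrt.2 hN1
  have hr0 : 0 < √N := by linarith
  have hmp := measurePreserving_piFinSuccAbove (fun _ : Fin (m + 1) => uniformLaw) j
  set G : ℝ × (Fin m → ℝ) → ℝ := fun z => |centredRank j z.1 z.2| ^ a with hG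
  have hGm : Measurable G := ((measurable_centredRank j).abs).pow_const a
  have hprod : ∀ᵐ z ∂(uniformLaw.prod (Measure.pi fun _ : Fin m => uniformLaw)),
      z.1 ∈ Set.Icc (0 : ℝ) 1 :=
    Measure.quasiMeasurePreserving_fst.ae ae_mem_Icc
  have hGi : Integrable G (uniformLaw.prod (Measure.pi fun _ : Fin m => uniformLaw)) := by
    refine Integrable.of_bound hGm.aestronglyMeasurable ((m : ℝ) ^ a) ?_
    filter_upwards [hprod] with z hz
    rw [Real.norm_eq_abs, abs_of_nonneg (by positivity)]
    exact pow_le_pow_left₀ (abs_nonneg _) (abs_centredRank_le j hz _) a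
  have hGle : ∫ z, G z ∂(uniformLaw.prod (Measure.pi fun _ : Fin m => uniformLaw)) ≤
      2 * a ! * Real.exp 1 * √N ^ a := by
    rw [integral_prod _ hGi]
    calc _ ≤ ∫ _t, 2 * a ! * Real.exp 1 * √N ^ a ∂uniformLaw := by
          refine integral_mono_ae hGi.integral_prod_left (integrable_const _) ?_
          filter_upwards [ae_mem_Icc] with t ht
          exact integral_abs_centredRank_pow_le j ht a
      _ = _ := by simp
  set H : (Fin (m + 1) → ℝ) → ℝ := fun x => G (x j, fun k => x (j.succAbove k)) with hH
  have hHi : Integrable H (Measure.pi fun _ => uniformLaw) := hmp.integrable_comp_of_integrable hGi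
  have hHle : ∫ x, H x ∂(Measure.pi fun _ => uniformLaw) ≤
      2 * a ! * Real.exp 1 * √N ^ a := by
    rw [← hmp.integral_comp'] at hGle
    exact hGle
  have hpt : ∀ᵐ x : Fin (m + 1) → ℝ ∂(Measure.pi fun _ => uniformLaw),
      |x j - (rank x j + 1 / 2 : ℝ) / N| ^ a ≤ 2 ^ a / N ^ a * (H x + 1) := by
    filter_upwards [ae_pi_mem_Icc (m + 1)] with x hx
    have hR := rank_sub_eq x j
    set c := centredRank j (x j) fun k => x (j.succAbove k) with hc
    have hHx : H x = |c| ^ a := rfl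
    -- The spare `x j` appears because `N = m + 1` while the rank is centred at `m * x j`.
    have h1 : x j - (rank x j + 1 / 2 : ℝ) / N = (x j - 1 / 2 - c) / N := by
      rw [← hR, hN]
      push_cast
      field_simp
      ring
    have h2 : |x j - 1 / 2 - c| ≤ |c| + 1 := by
      have h3 : |x j - 1 / 2| ≤ 1 :=
        abs_le.2 ⟨by linarith [(hx j).1], by linarith [(hx j).2]⟩
      linarith [abs_sub (x j - 1 / 2) c]
    rw [h1, abs_div, abs_of_pos hN0, div_pow, hHx, div_mul_eq_mul_div]
    gcongr
    calc |x j - 1 / 2 - c| ^ a ≤ (|c| + 1) ^ a := by gcongr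
      _ ≤ 2 ^ (a - 1) * (|c| ^ a + 1 ^ a) := add_pow_le (abs_nonneg c) zero_le_one a
      _ ≤ 2 ^ a * (|c| ^ a + 1) := by
          rw [one_pow]
          gcongr
          · norm_num
          · omega
  have hbi : Integrable (fun x => 2 ^ a / N ^ a * (H x + 1))
      (Measure.pi fun _ : Fin (m + 1) => uniformLaw) :=
    (hHi.add (integrable_const 1)).const_mul _
  have hmeas : Measurable fun x : Fin (m + 1) → ℝ => |x j - (rank x j + 1 / 2 : ℝ) / N| ^ a := by
    have hrank : Measurable fun x : Fin (m + 1) → ℝ => (rank x j : ℝ) := by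
      simp only [rank, Nat.cast_sum, Nat.cast_ite, Nat.cast_one, Nat.cast_zero]
      exact Finset.measurable_sum _ fun k _ =>
        measurable_indicator_lex (measurable_pi_apply k) (measurable_pi_apply j) _
    have hd : Measurable fun x : Fin (m + 1) → ℝ => x j - (rank x j + 1 / 2 : ℝ) / N :=
      (measurable_pi_apply j).sub ((hrank.add_const _).div_const _)
    exact hd.abs.pow_const a
  refine ⟨hbi.mono' hmeas.aestronglyMeasurable ?_, ?_⟩
  · filter_upwards [hpt] with x hx
    rwa [Real.norm_eq_abs, abs_of_nonneg (by positivity)]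
  calc _ ≤ ∫ x, 2 ^ a / N ^ a * (H x + 1) ∂(Measure.pi fun _ => uniformLaw) :=
        integral_mono_of_nonneg (ae_of_all _ fun x => by positivity) hbi hpt
    _ ≤ 2 ^ a / N ^ a * (2 * a ! * Real.exp 1 * √N ^ a + √N ^ a) := by
        rw [integral_const_mul, integral_add hHi (integrable_const 1)]
        have : (1 : ℝ) ≤ √N ^ a := one_le_pow₀ hr1
        simp only [integral_const, probReal_univ, smul_eq_mul, one_mul]
        gcongr
    _ = _ := by
        have h : N ^ a = √N ^ a * √N ^ a := by rw [← mul_pow, Real.mul_self_sqrt hN0.le]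
        rw [h, one_div, inv_pow]
        field_simp

theorem expectedMinCost_le {n : ℕ} (a : ℕ) {r : ℝ} (hn : 1 ≤ n)
    (hr : 1 / (2 * (n : ℝ)) ≤ r) :
    expectedMinCost n a r ≤ 2 ^ a * (2 * a ! * Real.exp 1 + 1) * (n * (1 / √(n : ℝ)) ^ a) := by
  obtain ⟨m, rfl⟩ : ∃ m, n = m + 1 := ⟨n - 1, by omega⟩
  calc expectedMinCost (m + 1) a r
      ≤ ∫ x : Fin (m + 1) → ℝ, ∑ j, |x j - (rank x j + 1 / 2 : ℝ) / (m + 1 : ℕ)| ^ a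
        ∂(Measure.pi fun _ => uniformLaw) :=
        integral_mono (integrable_minCost a hn hr)
          (integrable_finsetSum _ fun j _ => (integral_abs_sub_rank_pow_le a j).1)
          (minCost_le_sum_rank a hn hr)
    _ = ∑ j, ∫ x : Fin (m + 1) → ℝ, |x j - (rank x j + 1 / 2 : ℝ) / (m + 1 : ℕ)| ^ a
        ∂(Measure.pi fun _ => uniformLaw) :=
        integral_finsetSum _ fun j _ => (integral_abs_sub_rank_pow_le a j).1
    _ ≤ ∑ _j : Fin (m + 1), 2 ^ a * (2 * a ! * Real.exp 1 + 1) *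
          (1 / √((m + 1 : ℕ) : ℝ)) ^ a :=
        Finset.sum_le_sum fun j _ => (integral_abs_sub_rank_pow_le a j).2
    _ = _ := by
        rw [Finset.sum_const, Finset.card_univ, Fintype.card_fin, nsmul_eq_mul]
        ring


/-! ### Rigidity of the barycentre of a cover -/

/-- The point of the unit interval nearest to `b`. -/
noncomputable def clamp (b : ℝ) : ℝ := max 0 (min b 1)

theorem clamp_nonneg (b : ℝ) : 0 ≤ clamp b := le_max_left _ _

theorem clamp_one_sub (b : ℝ) : clamp (1 - b) = 1 - clamp b := by
  unfold clamp
  grind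

/-- Truncation never lengthens a move, and it keeps sensors sent far outside the interval from
spoiling the barycentre. -/
theorem abs_sub_clamp_le {x : ℝ} (hx : x ∈ Set.Icc (0 : ℝ) 1) (b : ℝ) :
    |x - clamp b| ≤ |x - b| := by
  obtain ⟨h0, h1⟩ := hx
  unfold clamp
  grind

theorem le_clamp_add {s b r : ℝ} (hs : s ∈ Set.Icc (0 : ℝ) 1) (hr : 0 ≤ r)
    (h : |s - b| ≤ r) : s ≤ clamp b + r := by
  have h1 := (le_abs_self _).trans h
  obtain ⟨h2, h3⟩ := hs
  unfold clamp
  grind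

theorem uniformLaw_integral (g : ℝ → ℝ) : ∫ t, g t ∂uniformLaw = ∫ t in (0 : ℝ)..1, g t := by
  rw [uniformLaw, integral_Icc_eq_integral_Ioc,
    intervalIntegral.integral_of_le zero_le_one]

theorem integrable_uniformLaw {g : ℝ → ℝ} (hg : Continuous g) : Integrable g uniformLaw :=
  (hg.continuousOn.integrableOn_compact isCompact_Icc)

/-- Integrate `s` over the unit interval: a point covered by sensor `i` satisfies `s ≤ clamp (b i) +
r`, and each sensor covers length at most `2 * r`. -/
theorem half_le_of_covers {n : ℕ} {r : ℝ} (hr : 0 ≤ r) {b : Fin n → ℝ} (hb : Covers r b) :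
    1 / 2 ≤ 2 * r * (∑ i, clamp (b i) + n * r) := by
  have hid : ∫ s, s ∂uniformLaw = 1 / 2 := by
    rw [uniformLaw_integral, integral_id]
    norm_num
  have hind : ∀ i, Integrable
      ((Set.Icc (b i - r) (b i + r)).indicator fun _ => clamp (b i) + r) uniformLaw :=
    fun i => (integrable_const _).indicator measurableSet_Icc
  calc (1 / 2 : ℝ) = ∫ s, s ∂uniformLaw := hid.symm
    _ ≤ ∫ s, ∑ i, (Set.Icc (b i - r) (b i + r)).indicator (fun _ => clamp (b i) + r) s
        ∂uniformLaw := by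
        refine integral_mono_ae (integrable_uniformLaw continuous_id)
          (integrable_finsetSum _ fun i _ => hind i) ?_
        filter_upwards [ae_mem_Icc] with s hs
        obtain ⟨i, hi⟩ := hb s hs
        have hi' := abs_le.1 hi
        calc s ≤ clamp (b i) + r := le_clamp_add hs hr hi
          _ = (Set.Icc (b i - r) (b i + r)).indicator (fun _ => clamp (b i) + r) s := by
              rw [Set.indicator_of_mem]
              exact ⟨by linarith [hi'.1], by linarith [hi'.2]⟩
          _ ≤ _ := Finset.single_le_sum (f := fun i =>
              (Set.Icc (b i - r) (b i + r)).indicator (fun _ => clamp (b i) + r) s)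
              (fun k _ => Set.indicator_nonneg
                (fun _ _ => add_nonneg (clamp_nonneg _) hr) _) (Finset.mem_univ i)
    _ = ∑ i, uniformLaw.real (Set.Icc (b i - r) (b i + r)) * (clamp (b i) + r) := by
        rw [integral_finsetSum _ fun i _ => hind i]
        refine Finset.sum_congr rfl fun i _ => ?_
        rw [integral_indicator_const _ measurableSet_Icc, smul_eq_mul]
    _ ≤ ∑ i, 2 * r * (clamp (b i) + r) := by
        refine Finset.sum_le_sum fun i _ =>
          mul_le_mul_of_nonneg_right ?_ (add_nonneg (clamp_nonneg _) hr)
        rw [measureReal_def]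
        refine ENNReal.toReal_le_of_le_ofReal (by positivity) ?_
        refine (Measure.restrict_apply_le _ _).trans ?_
        rw [Real.volume_Icc]
        exact ENNReal.ofReal_le_ofReal (by linarith)
    _ = _ := by
        rw [← Finset.mul_sum, Finset.sum_add_distrib]
        simp

theorem Covers.one_sub {n : ℕ} {r : ℝ} {b : Fin n → ℝ} (hb : Covers r b) :
    Covers r fun i => 1 - b i := by
  intro y hy
  obtain ⟨i, hi⟩ := hb (1 - y) ⟨by linarith [hy.2], by linarith [hy.1]⟩
  refine ⟨i, ?_⟩
  rw [abs_sub_comm]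
  convert hi using 2
  ring

/-- The barycentre of a placement that covers the unit interval with small overlap. -/
theorem abs_sum_clamp_sub_le {n : ℕ} (hn : 1 ≤ n) {d : ℝ} (hd : 0 ≤ d) {b : Fin n → ℝ}
    (hb : Covers (1 / (2 * (n : ℝ)) + d / 2) b) :
    |∑ i, clamp (b i) - n / 2| ≤ ((n : ℝ) ^ 2 * d + n * d + 1) / 2 := by
  have hn0 : (0 : ℝ) < n := by exact_mod_cast hn
  have key : ∀ b : Fin n → ℝ, Covers (1 / (2 * (n : ℝ)) + d / 2) b →
      (n : ℝ) / 2 - ((n : ℝ) ^ 2 * d + n * d + 1) / 2 ≤ ∑ i, clamp (b i) := by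
    intro b hb
    have h := half_le_of_covers (by positivity) hb
    set P := ∑ i, clamp (b i)
    have h1 : 2 * (1 / (2 * (n : ℝ)) + d / 2) * (P + n * (1 / (2 * (n : ℝ)) + d / 2)) =
        (1 + n * d) * (P + (1 + n * d) / 2) / n := by
      field_simp
    rw [h1, le_div_iff₀ hn0] at h
    have hp : 0 < 1 + n * d := by positivity
    -- The left side is `(1 - (n * d) ^ 2) * n / 2 ≤ n / 2`; written so, the factor `1 + n * d`
    -- cancels.
    have h2 : (1 + n * d) * ((1 - n * d) * n / 2) ≤ (1 + n * d) * (P + (1 + n * d) / 2) := by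
      nlinarith [mul_nonneg hn0.le (sq_nonneg (n * d))]
    have h3 := le_of_mul_le_mul_left h2 hp
    nlinarith
  have h1 := key b hb
  -- Reflecting the interval turns the lower bound into the upper one.
  have h2 := key _ hb.one_sub
  simp only [clamp_one_sub, Finset.sum_sub_distrib, Finset.sum_const, Finset.card_univ,
    Fintype.card_fin, nsmul_eq_mul, mul_one] at h2
  exact abs_le.2 ⟨by linarith, by linarith⟩

/-! ### From total displacement to its powers -/

/-- Bernoulli's inequality for `d / A`. Being linear in `d`, the bound can be summed over sensors
and integrated. -/
theorem pow_tangent_le {A d : ℝ} (hA : 0 < A) (hd : 0 ≤ d) (a : ℕ) :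
    A ^ a * (1 + a * (d / A - 1)) ≤ d ^ a := by
  have h := one_add_mul_sub_le_pow (a := d / A) (by linarith [div_nonneg hd hA.le]) a
  rw [div_pow, le_div_iff₀ (by positivity)] at h
  linarith

theorem le_minCost {n : ℕ} (a : ℕ) (hn : 1 ≤ n) {d : ℝ} (hd : 0 ≤ d) {A : ℝ} (hA : 0 < A)
    {x : Fin n → ℝ} (hx : ∀ i, x i ∈ Set.Icc (0 : ℝ) 1) :
    A ^ a * (n + a * ((|∑ i, (x i - 1 / 2)| - ((n : ℝ) ^ 2 * d + n * d + 1) / 2) / A - n)) ≤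
      minCost a (1 / (2 * (n : ℝ)) + d / 2) x := by
  refine le_csInf ⟨_, _, covers_of_perm hn (by linarith) (rank_surjective x), rfl⟩ ?_
  rintro _ ⟨b, hb, rfl⟩
  have h1 : |∑ i, (x i - 1 / 2)| - ((n : ℝ) ^ 2 * d + n * d + 1) / 2 ≤ ∑ i, |x i - b i| := by
    have h2 : ∑ i, (x i - 1 / 2) = ∑ i, (x i - clamp (b i)) + (∑ i, clamp (b i) - n / 2) := by
      simp only [Finset.sum_sub_distrib, Finset.sum_const, Finset.card_univ, Fintype.card_fin,
        nsmul_eq_mul]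
      ring
    have h3 : |∑ i, (x i - clamp (b i))| ≤ ∑ i, |x i - b i| :=
      (Finset.abs_sum_le_sum_abs _ _).trans
        (Finset.sum_le_sum fun i _ => abs_sub_clamp_le (hx i) (b i))
    have h4 := abs_sum_clamp_sub_le hn hd hb
    have h5 := abs_add_le (∑ i, (x i - clamp (b i))) (∑ i, clamp (b i) - n / 2)
    rw [← h2] at h5
    linarith
  calc _ ≤ A ^ a * (n + a * ((∑ i, |x i - b i|) / A - n)) := by gcongr
    _ = ∑ i, A ^ a * (1 + a * (|x i - b i| / A - 1)) := by
        rw [← Finset.mul_sum, Finset.sum_add_distrib, ← Finset.mul_sum, Finset.sum_sub_distrib,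
          ← Finset.sum_div]
        simp
    _ ≤ cost a x b := Finset.sum_le_sum fun i _ => pow_tangent_le hA (abs_nonneg _) a

/-! ### The first absolute moment of the initial barycentre -/

/-- Bounds a first absolute moment from below by the second and fourth moments, after rescaling. -/
theorem sub_le_abs (y : ℝ) : y ^ 2 - y ^ 4 ≤ |y| := by
  have h := abs_nonneg y
  have h2 : y ^ 2 = |y| ^ 2 := (sq_abs y).symm
  have h4 : y ^ 4 = |y| ^ 4 := by rw [show 4 = 2 * 2 from rfl, pow_mul, h2, ← pow_mul]
  rw [h2, h4]
  have : 0 ≤ |y| * (1 - |y| + |y| ^ 3) := by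
    refine mul_nonneg h ?_
    rcases le_total |y| 1 with h1 | h1
    · linarith [pow_nonneg h 3]
    · linarith [le_self_pow₀ h1 (three_ne_zero)]
  nlinarith

theorem ae_abs_sub_half_le : ∀ᵐ t ∂uniformLaw, |t - 1 / 2| ≤ 1 := by
  filter_upwards [ae_mem_Icc] with t ht
  exact abs_le.2 ⟨by linarith [ht.1], by linarith [ht.2]⟩

theorem integral_sub_half : ∫ t, (t - 1 / 2) ∂uniformLaw = 0 := by
  rw [uniformLaw_integral, intervalIntegral.integral_comp_sub_right (fun t => t)]
  norm_num

theorem integral_sub_half_sq : ∫ t, (t - 1 / 2) ^ 2 ∂uniformLaw = 1 / 12 := by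
  rw [uniformLaw_integral, intervalIntegral.integral_comp_sub_right (fun t => t ^ 2)]
  norm_num

theorem integrable_sum_sub_half (n : ℕ) {h : ℝ → ℝ} (hh : Continuous h) :
    Integrable (fun x : Fin n → ℝ => h (∑ i, (x i - 1 / 2)))
      (Measure.pi fun _ => uniformLaw) := by
  obtain ⟨C, hC⟩ := (isCompact_Icc (a := -(n : ℝ)) (b := n)).exists_bound_of_continuousOn
    hh.continuousOn
  refine Integrable.of_bound (hh.comp (by fun_prop)).aestronglyMeasurable C ?_
  filter_upwards [ae_pi_mem_Icc n] with x hx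
  refine hC _ (abs_le.1 ((Finset.abs_sum_le_sum_abs _ _).trans ?_))
  calc ∑ i, |x i - 1 / 2| ≤ ∑ _i : Fin n, (1 : ℝ) :=
        Finset.sum_le_sum fun i _ =>
          abs_le.2 ⟨by linarith [(hx i).1], by linarith [(hx i).2]⟩
    _ = n := by simp

theorem integral_sum_sub_half_sq (n : ℕ) :
    ∫ x : Fin n → ℝ, (∑ i, (x i - 1 / 2)) ^ 2 ∂(Measure.pi fun _ => uniformLaw) = n / 12 := by
  have hm : MemLp (fun t : ℝ => t - 1 / 2) 2 uniformLaw :=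
    MemLp.of_bound (by fun_prop) 1 ae_abs_sub_half_le
  have hv := ProbabilityTheory.variance_sum_pi (μ := fun _ : Fin n => uniformLaw)
    (X := fun _ t => t - 1 / 2) fun _ => hm
  have h1 : ProbabilityTheory.variance (fun t : ℝ => t - 1 / 2) uniformLaw = 1 / 12 := by
    rw [ProbabilityTheory.variance_of_integral_eq_zero (by fun_prop) integral_sub_half]
    exact integral_sub_half_sq
  have hsum : (∑ i, fun ω : Fin n → ℝ => ω i - 1 / 2) = fun ω => ∑ i, (ω i - 1 / 2) := by
    funext ω
    simp
  have h0 : ∫ x : Fin n → ℝ, ∑ i, (x i - 1 / 2) ∂(Measure.pi fun _ => uniformLaw) = 0 := by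
    have hcomp : ∀ i : Fin n,
        ∫ x : Fin n → ℝ, (x i - 1 / 2) ∂(Measure.pi fun _ => uniformLaw) = 0 := fun i => by
      rw [integral_comp_eval (μ := fun _ : Fin n => uniformLaw) (f := fun t : ℝ => t - 1 / 2)
        (by fun_prop), integral_sub_half]
    rw [integral_finsetSum]
    · exact Finset.sum_eq_zero fun i _ => hcomp i
    · exact fun i _ => integrable_comp_eval (μ := fun _ : Fin n => uniformLaw)
        (f := fun t : ℝ => t - 1 / 2) (hm.integrable (by norm_num))
  rw [hsum, ProbabilityTheory.variance_of_integral_eq_zero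
    (Continuous.aemeasurable (by fun_prop)) h0] at hv
  rw [hv, Finset.sum_congr rfl fun i _ => h1]
  simp
  ring

theorem le_integral_abs_sum_sub_half {n : ℕ} (hn : 1 ≤ n) :
    √(n : ℝ) / 1440 ≤
      ∫ x : Fin n → ℝ, |∑ i, (x i - 1 / 2)| ∂(Measure.pi fun _ => uniformLaw) := by
  have hn0 : (0 : ℝ) < n := by exact_mod_cast hn
  have hr : 0 < √(n : ℝ) := Real.sqrt_pos.2 hn0
  have hr2 : √(n : ℝ) ^ 2 = n := Real.sq_sqrt hn0.le
  -- At this scale the second moment is `1 / 43200` and the fourth at most `1 / 90000`, leaving more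
  -- than `1 / 86400`.
  set u : ℝ := (60 * √(n : ℝ))⁻¹ with hu
  have hu0 : 0 < u := by positivity
  have h4 : ∫ x : Fin n → ℝ, (∑ i, (x i - 1 / 2)) ^ 4 ∂(Measure.pi fun _ => uniformLaw) ≤
      144 * (n : ℝ) ^ 2 := by
    have h := integral_abs_sum_pow_le hn le_rfl (μ := uniformLaw)
      (g := fun (_ : Fin n) t => t - 1 / 2) (fun _ => by fun_prop)
      (fun _ => ae_abs_sub_half_le) (fun _ => integral_sub_half) 4
    have he : ∀ x : Fin n → ℝ, |∑ i, (x i - 1 / 2)| ^ 4 = (∑ i, (x i - 1 / 2)) ^ 4 :=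
      fun x => (by decide : Even 4).pow_abs _
    simp only [he] at h
    have h5 : √(n : ℝ) ^ 4 = (n : ℝ) ^ 2 := by
      rw [show 4 = 2 * 2 from rfl, pow_mul, hr2]
    rw [h5] at h
    refine h.trans ?_
    have h6 := Real.exp_one_lt_d9
    have h7 : ((4 ! : ℕ) : ℝ) = 24 := by norm_num [Nat.factorial]
    rw [h7]
    gcongr
    linarith
  have i1 := integrable_sum_sub_half n (h := fun s => (u * s) ^ 2) (by fun_prop)
  have i2 := integrable_sum_sub_half n (h := fun s => (u * s) ^ 4) (by fun_prop)
  have i3 := integrable_sum_sub_half n (h := fun s => |u * s|) (by fun_prop)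
  have hmono := integral_mono (i1.sub i2) i3 fun x => sub_le_abs (u * ∑ i, (x i - 1 / 2))
  simp only [Pi.sub_apply] at hmono
  rw [integral_sub i1 i2] at hmono
  simp only [mul_pow, abs_mul, integral_const_mul, integral_sum_sub_half_sq,
    abs_of_pos hu0] at hmono
  have h5 : u ^ 4 * ∫ x : Fin n → ℝ, (∑ i, (x i - 1 / 2)) ^ 4
      ∂(Measure.pi fun _ => uniformLaw) ≤ u ^ 4 * (144 * (n : ℝ) ^ 2) := by gcongr
  have hun : u ^ 2 * n = 1 / 3600 := by
    rw [hu, inv_pow, mul_pow, hr2]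
    field_simp
    norm_num
  have hun4 : u ^ 4 * (144 * (n : ℝ) ^ 2) = 144 * (1 / 3600) ^ 2 := by
    rw [← hun]
    ring
  have h6 : (1 : ℝ) / 86400 ≤
      u * ∫ x : Fin n → ℝ, |∑ i, (x i - 1 / 2)| ∂(Measure.pi fun _ => uniformLaw) := by
    have : u ^ 2 * ((n : ℝ) / 12) = 1 / 43200 := by
      rw [← mul_div_assoc, hun]
      norm_num
    rw [hun4] at h5
    rw [this] at hmono
    linarith
  rw [hu, inv_mul_eq_div, le_div_iff₀ (by positivity)] at h6
  linarith

/-! ### The lower bound and the asymptotics -/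

theorem le_expectedMinCost {n : ℕ} (a : ℕ) (hn : 1 ≤ n) {d : ℝ} (hd : 0 ≤ d)
    (hsmall : ((n : ℝ) ^ 2 * d + n * d + 1) / 2 ≤ √(n : ℝ) / 2880) :
    (1 / 2880) ^ a * (n * (1 / √(n : ℝ)) ^ a) ≤
      expectedMinCost n a (1 / (2 * (n : ℝ)) + d / 2) := by
  have hn0 : (0 : ℝ) < n := by exact_mod_cast hn
  have hr : 0 < √(n : ℝ) := Real.sqrt_pos.2 hn0
  set e := ((n : ℝ) ^ 2 * d + n * d + 1) / 2 with he
  -- Half of the mean `√n / 1440` absorbs the error `e`; the other half is `n * A`, so the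
  -- coefficient of `a` is nonnegative after integration.
  set A : ℝ := 1 / 2880 * (1 / √(n : ℝ)) with hA
  have hA0 : 0 < A := by positivity
  have hnA : n * A = √(n : ℝ) / 2880 := by
    rw [hA]
    nth_rw 1 [← Real.mul_self_sqrt hn0.le]
    field_simp
  have hi : Integrable (fun x : Fin n → ℝ => |∑ i, (x i - 1 / 2)|)
      (Measure.pi fun _ => uniformLaw) := integrable_sum_sub_half n continuous_abs
  have hi0 : Integrable (fun x : Fin n → ℝ => (|∑ i, (x i - 1 / 2)| - e) / A)
      (Measure.pi fun _ => uniformLaw) := (hi.sub (integrable_const e)).div_const A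
  have hi1 : Integrable (fun x : Fin n → ℝ => (|∑ i, (x i - 1 / 2)| - e) / A - n)
      (Measure.pi fun _ => uniformLaw) :=
    hi0.sub (integrable_const _)
  have hi2 : Integrable (fun x : Fin n → ℝ =>
      n + a * ((|∑ i, (x i - 1 / 2)| - e) / A - n)) (Measure.pi fun _ => uniformLaw) :=
    (integrable_const _).add (hi1.const_mul _)
  calc (1 / 2880) ^ a * (n * (1 / √(n : ℝ)) ^ a) = A ^ a * (n + a * 0) := by
        rw [hA, mul_pow]
        ring
    _ ≤ A ^ a * (n + a * ((∫ x : Fin n → ℝ, |∑ i, (x i - 1 / 2)|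
          ∂(Measure.pi fun _ => uniformLaw) - e) / A - n)) := by
        gcongr
        rw [sub_nonneg, le_div_iff₀ hA0, hnA]
        linarith [le_integral_abs_sum_sub_half hn]
    _ = ∫ x : Fin n → ℝ, A ^ a * (n + a * ((|∑ i, (x i - 1 / 2)| - e) / A - n))
          ∂(Measure.pi fun _ => uniformLaw) := by
        rw [integral_const_mul, integral_add (integrable_const _) (hi1.const_mul _),
          integral_const_mul, integral_sub hi0 (integrable_const _), integral_div, integral_sub hi (integrable_const e)]
        simp
    _ ≤ expectedMinCost n a (1 / (2 * (n : ℝ)) + d / 2) := by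
        refine integral_mono_ae (hi2.const_mul _) (integrable_minCost a hn (by linarith)) ?_
        filter_upwards [ae_pi_mem_Icc n] with x hx
        exact le_minCost a hn hd hA0 hx

/-- The exponent `-3/2` enters here: it makes `n ^ 2 * f n` negligible against `√n`. -/
theorem eventually_overlap_le {f : ℕ → ℝ} (hf_pos : ∀ n : ℕ, 1 ≤ n → 0 < f n)
    (hf : f =o[atTop] fun n : ℕ => (n : ℝ) ^ (-(3 / 2) : ℝ)) {c : ℝ} (hc : 0 < c) :
    ∀ᶠ n : ℕ in atTop, ((n : ℝ) ^ 2 * f n + n * f n + 1) / 2 ≤ √(n : ℝ) * c := by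
  have hlarge : ∀ᶠ n : ℕ in atTop, 1 / c ≤ √(n : ℝ) :=
    (Real.tendsto_sqrt_atTop.comp tendsto_natCast_atTop_atTop).eventually_ge_atTop _
  filter_upwards [hf.bound (half_pos hc), eventually_ge_atTop 1, hlarge] with n h hn hl
  have hn1 : (1 : ℝ) ≤ n := by exact_mod_cast hn
  have hn0 : (0 : ℝ) < n := by linarith
  rw [Real.norm_of_nonneg (hf_pos n hn).le, Real.norm_of_nonneg (by positivity)] at h
  have hpow : (n : ℝ) ^ 2 * (n : ℝ) ^ (-(3 / 2) : ℝ) = √(n : ℝ) := by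
    rw [← Real.rpow_natCast, ← Real.rpow_add hn0, Real.sqrt_eq_rpow]
    norm_num
  have h1 : (n : ℝ) ^ 2 * f n ≤ c / 2 * √(n : ℝ) := by
    calc (n : ℝ) ^ 2 * f n ≤ (n : ℝ) ^ 2 * (c / 2 * (n : ℝ) ^ (-(3 / 2) : ℝ)) := by gcongr
      _ = _ := by rw [← hpow]; ring
  have h2 : n * f n ≤ (n : ℝ) ^ 2 * f n := by
    have := (hf_pos n hn).le
    gcongr
    nlinarith
  rw [div_le_iff₀ hc] at hl
  linarith

theorem one_div_rpow_eq {n : ℕ} (hn : 1 ≤ n) (a : ℕ) :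
    1 / (n : ℝ) ^ ((a : ℝ) / 2 - 1) = n * (1 / √(n : ℝ)) ^ a := by
  have hn0 : (0 : ℝ) < n := by exact_mod_cast hn
  have h : √(n : ℝ) ^ a = (n : ℝ) ^ ((a : ℝ) / 2) := by
    rw [Real.sqrt_eq_rpow, ← Real.rpow_natCast, ← Real.rpow_mul hn0.le]
    congr 1
    ring
  rw [one_div_pow, h, Real.rpow_sub_one hn0.ne']
  field_simp

theorem expectedMinCost_nonneg (n a : ℕ) (r : ℝ) : 0 ≤ expectedMinCost n a r :=
  integral_nonneg fun x => minCost_nonneg a r x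

end SensorCover

theorem mainTheorem3 (a : ℕ) (ha : 1 ≤ a) (f : ℕ → ℝ) (hf_pos : ∀ n : ℕ, 1 ≤ n → 0 < f n)
    (hf : f =o[atTop] fun n : ℕ => (n : ℝ) ^ (-(3 / 2) : ℝ)) :
    (fun n : ℕ => SensorCover.expectedMinCost n a (1 / (2 * (n : ℝ)) + f n / 2)) =Θ[atTop]
      fun n : ℕ => 1 / (n : ℝ) ^ ((a : ℝ) / 2 - 1) := by
  open SensorCover in
  constructor
  · refine IsBigO.of_bound (2 ^ a * (2 * a.factorial * Real.exp 1 + 1)) ?_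
    filter_upwards [eventually_ge_atTop 1] with n hn
    rw [Real.norm_of_nonneg (expectedMinCost_nonneg n a _), Real.norm_of_nonneg (by positivity),
      one_div_rpow_eq hn]
    exact expectedMinCost_le a hn (by linarith [hf_pos n hn])
  · refine IsBigO.of_bound (2880 ^ a) ?_
    filter_upwards [eventually_ge_atTop 1,
      eventually_overlap_le hf_pos hf (c := 1 / 2880) (by norm_num)] with n hn hsmall
    rw [Real.norm_of_nonneg (expectedMinCost_nonneg n a _), Real.norm_of_nonneg (by positivity),
      one_div_rpow_eq hn]
    have h := le_expectedMinCost a hn (hf_pos n hn).le (by linarith)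
    rw [one_div_pow, one_div_mul_eq_div, div_le_iff₀ (by positivity)] at h
    linarith
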